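/- For a real sequence $x=(x(i))_{i\ge 0}$ with $\sum_i|x(i)|<\infty$ let $E(x)=\{\sum_{i}\varepsilon_i x(i):\varepsilon_i\in\{0,1\}\}$ be its achievement set. For positive integers $k_1,\dots,k_m$ ($m\ge 1$) and $q\in(0,\tfrac12)$ let $E(k_1,\dots,k_m;q)$ be the achievement set of the sequence $(k_1,\dots,k_m,k_1q,\dots,k_mq,k_1q^2,\dots,k_mq^2,\dots)$. A Cantorval is a nonempty compact set $S\subset\mathbb R$ that is the closure of its interior and such that both endpoints of every connected component of $S$ with nonempty interior are accumulation points of the set of one-point components of $S$. Theorem. Let $k_1\ge k_2\ge\dots\ge k_m$ be positive integers, $K=\sum_{i=1}^m k_i$, and $q\in(0,\tfrac12)$. Assume that $n_0$ and $n$ are positive integers such that each of the numbers $n_0,n_0+1,\dots,n_0+n$ is of the form $\sum_{i=1}^m\varepsilon_ik_i$ with $\varepsilon_i\in\{0,1\}$. (1) If $q\ge\frac1{n+1}$, then $E(k_1,\dots,k_m;q)$ has nonempty interior. (2) If $q<\frac{k_m}{K+k_m}$, then $E(k_1,\dots,k_m;q)$ is not a finite union of intervals. (3) Consequently, if $\frac1{n+1}\le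 q<\frac{k_m}{K+k_m}$, then $E(k_1,\dots,k_m;q)$ is a Cantorval. -/

import Mathlib

open Filter Topology

noncomputable section

/-- The achievement set `E(x)` of a real sequence `x`: the set of all subsums
`∑ εₙ x(n)` with every `εₙ` in `{0, 1}`. -/
def achievementSet (x : ℕ → ℝ) : Set ℝ :=
  {t | ∃ ε : ℕ → ℝ, (∀ n, ε n = 0 ∨ ε n = 1) ∧ HasSum (fun n => ε n * x n) t}

/-- The multigeometric sequence
`(k₁, …, k_m, k₁ q, …, k_m q, k₁ q², …, k_m q², …)`;
the indices of `k` and of the sequence start at `0`. -/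
def multigeometric {m : ℕ} (hm : 0 < m) (k : Fin m → ℕ) (q : ℝ) : ℕ → ℝ :=
  fun i => (k ⟨i % m, Nat.mod_lt i hm⟩ : ℝ) * q ^ (i / m)

/-- `s` is a subsum of the finite family `k`: `s = ∑ εᵢ kᵢ` with every `εᵢ` in `{0, 1}`. -/
def IsSubsum {m : ℕ} (k : Fin m → ℕ) (s : ℕ) : Prop :=
  ∃ ε : Fin m → ℕ, (∀ i, ε i = 0 ∨ ε i = 1) ∧ s = ∑ i, ε i * k i

/-- `S` is a finite union of intervals. The intervals may be open, closed or half-open,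
bounded or unbounded, and degenerate ones are allowed. -/
def IsFiniteUnionOfIntervals (S : Set ℝ) : Prop :=
  ∃ I : Set (Set ℝ), I.Finite ∧ (∀ J ∈ I, J.OrdConnected) ∧ S = ⋃₀ I

/-- The union of the one-point components of `S`. -/
def onePointComponents (S : Set ℝ) : Set ℝ :=
  {z | z ∈ S ∧ connectedComponentIn S z = {z}}

/-- `S` is a Cantorval (`M`-Cantorval): a nonempty compact subset of the line that is the
closure of its interior, and such that both endpoints of any component with nonempty interior
are accumulation points of one-point components of `S`. A component of a compact set is
a compact interval, so its endpoints are its least and its greatest element. -/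
structure IsCantorval (S : Set ℝ) : Prop where
  nonempty : S.Nonempty
  isCompact : IsCompact S
  closure_interior : closure (interior S) = S
  accPt_left : ∀ x ∈ S, (interior (connectedComponentIn S x)).Nonempty →
    ∀ a, IsLeast (connectedComponentIn S x) a → AccPt a (𝓟 (onePointComponents S))
  accPt_right : ∀ x ∈ S, (interior (connectedComponentIn S x)).Nonempty →
    ∀ b, IsGreatest (connectedComponentIn S x) b → AccPt b (𝓟 (onePointComponents S))

end

open Set

/-! Grouping terms into blocks turns the achievement set into E = {∑ aₙqⁿ : aₙ ∈ D}, D being the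
subsums of k, so E = D + qE and E = P_N + q^N E with P_N finite. Interior: if q(n+1) ≥ 1, the copies
d + qI with d = n₀, …, n₀+n cover I = [n₀/(1-q), (n₀+n)/(1-q)], so I ⊆ E. Gaps: with κ = k_m the
least nonzero digit, q < κ/(K+κ) says qK/(1-q) < κ. This leaves a gap below κ, and its copies scaled
by q^j accumulate at 0. Cantorval: at the right endpoint h of any gap, E looks to the right like h +
q^N E, so gaps accumulate at h and {h} is a component (`exists_notMem_digitSet_right`). Such points
accumulate at the left end of each nondegenerate component; the symmetry t ↦ K/(1-q) - t handles
right ends. -/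

/-- The numbers `∑ aₙ qⁿ` whose digits `aₙ` all lie in `D`. -/
def digitSet (D : Set ℝ) (q : ℝ) : Set ℝ :=
  {t | ∃ a : ℕ → ℝ, (∀ n, a n ∈ D) ∧ HasSum (fun n => a n * q ^ n) t}

/-- The numbers `∑ aₙ qⁿ`, the sum being over `n < N`, whose digits `aₙ` all lie in `D`. -/
def digitPartialSums (D : Set ℝ) (q : ℝ) : ℕ → Set ℝ
  | 0 => {0}
  | N + 1 => image2 (fun d s => d + q * s) D (digitPartialSums D q N)

/-! ### Self-similar digit sets: compactness, interior and gaps -/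

section DigitSet

variable {D : Set ℝ} {q K : ℝ}

theorem summable_digits (hq0 : 0 < q) (hq1 : q < 1) (hD : D ⊆ Icc 0 K) {a : ℕ → ℝ}
    (ha : ∀ n, a n ∈ D) : Summable fun n => a n * q ^ n :=
  Summable.of_nonneg_of_le (fun n => mul_nonneg (hD (ha n)).1 (by positivity))
    (fun n => mul_le_mul_of_nonneg_right (hD (ha n)).2 (by positivity))
    ((summable_geometric_of_lt_one hq0.le hq1).mul_left K)

theorem zero_mem_digitSet (h0 : (0 : ℝ) ∈ D) : (0 : ℝ) ∈ digitSet D q :=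
  ⟨fun _ => 0, fun _ => h0, by simp [hasSum_zero]⟩

theorem digitSet_subset_Icc (hq0 : 0 < q) (hq1 : q < 1) (hD : D ⊆ Icc 0 K) :
    digitSet D q ⊆ Icc 0 (K / (1 - q)) := by
  rintro x ⟨a, ha, hx⟩
  refine ⟨hx.nonneg fun n => mul_nonneg (hD (ha n)).1 (by positivity), ?_⟩
  rw [div_eq_mul_inv]
  exact hasSum_le (fun n => mul_le_mul_of_nonneg_right (hD (ha n)).2 (by positivity)) hx
    ((hasSum_geometric_of_lt_one hq0.le hq1).mul_left K)

theorem mem_digitSet_iff {x : ℝ} (hq0 : 0 < q) :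
    x ∈ digitSet D q ↔ ∃ d ∈ D, ∃ y ∈ digitSet D q, x = d + q * y := by
  constructor
  · rintro ⟨a, ha, hx⟩
    refine ⟨a 0, ha 0, (x - a 0) / q, ⟨fun n => a (n + 1), fun n => ha _, ?_⟩, by field_simp; ring⟩
    have h := (hasSum_nat_add_iff' 1).2 hx
    simp only [Finset.sum_range_one, pow_zero, mul_one] at h
    have hterm : ∀ n, a (n + 1) * q ^ (n + 1) / q = a (n + 1) * q ^ n := fun n => by
      rw [pow_succ]
      field_simp
    simpa only [hterm] using h.div_const q
  · rintro ⟨d, hd, y, ⟨a, ha, hy⟩, rfl⟩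
    refine ⟨fun n => n.casesOn d a, fun n => by cases n <;> simp [hd, ha], ?_⟩
    rw [← hasSum_nat_add_iff' 1]
    have hsimp : d + q * y - ∑ i ∈ Finset.range 1, (Nat.casesOn i d a : ℝ) * q ^ i = q * y := by
      simp
    rw [hsimp]
    have hterm : ∀ n, q * (a n * q ^ n) = a n * q ^ (n + 1) := fun n => by ring
    simpa only [hterm] using hy.mul_left q

theorem mem_digitSet_iff_partialSums (hq0 : 0 < q) (N : ℕ) {x : ℝ} :
    x ∈ digitSet D q ↔
      ∃ s ∈ digitPartialSums D q N, ∃ y ∈ digitSet D q, x = s + q ^ N * y := by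
  induction N generalizing x with
  | zero => simp [digitPartialSums]
  | succ N ih =>
    rw [mem_digitSet_iff hq0]
    constructor
    · rintro ⟨d, hd, y, hy, rfl⟩
      obtain ⟨s, hs, z, hz, rfl⟩ := ih.1 hy
      exact ⟨_, mem_image2_of_mem hd hs, z, hz, by ring⟩
    · rintro ⟨_, ⟨d, hd, s, hs, rfl⟩, z, hz, rfl⟩
      exact ⟨d, hd, _, ih.2 ⟨s, hs, z, hz, rfl⟩, by ring⟩

theorem digitPartialSums_finite (hfin : D.Finite) (N : ℕ) : (digitPartialSums D q N).Finite := by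
  induction N with
  | zero => exact finite_singleton 0
  | succ N ih => exact hfin.image2 _ ih

theorem digitPartialSums_subset (hq0 : 0 < q) (h0 : (0 : ℝ) ∈ D) (N : ℕ) :
    digitPartialSums D q N ⊆ digitSet D q := fun s hs =>
  (mem_digitSet_iff_partialSums hq0 N).2 ⟨s, hs, 0, zero_mem_digitSet h0, by simp⟩

/-- A continuous image of the compact product of countably many copies of the finite set D. -/
theorem isCompact_digitSet (hq0 : 0 < q) (hq1 : q < 1) (hfin : D.Finite) (hD : D ⊆ Icc 0 K) :
    IsCompact (digitSet D q) := by
  have : Finite D := hfin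
  have hcont : Continuous fun a : ℕ → D => ∑' n, (a n : ℝ) * q ^ n := by
    refine continuous_tsum (fun n => by fun_prop)
      ((summable_geometric_of_lt_one hq0.le hq1).mul_left K) fun n a => ?_
    rw [Real.norm_of_nonneg (mul_nonneg (hD (a n).2).1 (by positivity))]
    exact mul_le_mul_of_nonneg_right (hD (a n).2).2 (by positivity)
  convert isCompact_range hcont using 1
  ext x
  constructor
  · rintro ⟨a, ha, hx⟩
    exact ⟨fun n => ⟨a n, ha n⟩, hx.tsum_eq⟩
  · rintro ⟨a, rfl⟩
    exact ⟨fun n => a n, fun n => (a n).2,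
      (summable_digits hq0 hq1 hD fun n => (a n).2).hasSum⟩

theorem sub_mem_digitSet (hq0 : 0 < q) (hq1 : q < 1) (hsymm : ∀ d ∈ D, K - d ∈ D) {x : ℝ}
    (hx : x ∈ digitSet D q) : K / (1 - q) - x ∈ digitSet D q := by
  obtain ⟨a, ha, hx⟩ := hx
  refine ⟨fun n => K - a n, fun n => hsymm _ (ha n), ?_⟩
  simp only [sub_mul, div_eq_mul_inv]
  exact ((hasSum_geometric_of_lt_one hq0.le hq1).mul_left K).sub hx

/-- Self-similarity puts a small copy s + q^N w of one interior point w near any point s + q^N y. -/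
theorem closure_interior_digitSet (hq0 : 0 < q) (hq1 : q < 1) (hfin : D.Finite)
    (hD : D ⊆ Icc 0 K) (hint : (interior (digitSet D q)).Nonempty) :
    closure (interior (digitSet D q)) = digitSet D q := by
  refine Subset.antisymm
    ((isCompact_digitSet hq0 hq1 hfin hD).isClosed.closure_interior_subset) fun x hx => ?_
  obtain ⟨w, hw⟩ := hint
  rw [Metric.mem_closure_iff]
  intro ε hε
  have hlim : Tendsto (fun N : ℕ => q ^ N * (K / (1 - q))) atTop (𝓝 0) := by
    simpa using (tendsto_pow_atTop_nhds_zero_of_lt_one hq0.le hq1).mul_const (K / (1 - q))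
  obtain ⟨N, hN⟩ := (hlim.eventually_lt_const hε).exists
  obtain ⟨s, hs, y, hy, rfl⟩ := (mem_digitSet_iff_partialSums hq0 N).1 hx
  have hqN : 0 < q ^ N := pow_pos hq0 N
  refine ⟨s + q ^ N * w, ?_, ?_⟩
  · have hopen : IsOpenMap fun t : ℝ => s + q ^ N * t :=
      (isOpenMap_add_left s).comp (Homeomorph.mulLeft₀ _ hqN.ne').isOpenMap
    refine interior_maximal ?_ (hopen _ isOpen_interior) (mem_image_of_mem _ hw)
    rintro _ ⟨t, ht, rfl⟩
    exact (mem_digitSet_iff_partialSums hq0 N).2 ⟨s, hs, t, interior_subset ht, rfl⟩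
  · have h1 := digitSet_subset_Icc hq0 hq1 hD hy
    have h2 := digitSet_subset_Icc hq0 hq1 hD (interior_subset hw)
    refine lt_of_le_of_lt ?_ hN
    rw [Real.dist_eq, add_sub_add_left_eq_sub, ← mul_sub, abs_mul, abs_of_pos hqN]
    refine mul_le_mul_of_nonneg_left (abs_le.2 ⟨?_, ?_⟩) hqN.le <;> linarith [h1.1, h1.2, h2.1, h2.2]

/-- If the digits contain `n₀, …, n₀ + n` and `q ≥ 1 / (n + 1)`, then the digit set contains
an interval. -/
theorem Icc_subset_digitSet (hq0 : 0 < q) (hq1 : q < 1) (hD : D ⊆ Icc 0 K) {n₀ n : ℕ}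
    (hsub : ∀ j ≤ n, ((n₀ + j : ℕ) : ℝ) ∈ D) (hn : 1 / ((n : ℝ) + 1) ≤ q) :
    Icc (n₀ / (1 - q)) ((n₀ + n) / (1 - q)) ⊆ digitSet D q := by
  have h1q : 0 < 1 - q := by linarith
  have hnq : 1 ≤ q * (n + 1) := by rwa [div_le_iff₀ (by positivity)] at hn
  set I := Icc ((n₀ : ℝ) / (1 - q)) ((n₀ + n) / (1 - q))
  have step : ∀ x : I, ∃ p : ℝ × I, p.1 ∈ D ∧ (x : ℝ) = p.1 + q * p.2 := by
    rintro ⟨x, hx1, hx2⟩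
    rw [div_le_iff₀ h1q] at hx1
    rw [le_div_iff₀ h1q] at hx2
    -- The digit n₀ + j must leave a remainder in qI. Take j = min(⌊x - n₀/(1-q)⌋, n); this works
    -- because qI has length qn/(1-q) ≥ 1.
    obtain ⟨j, hj, hj1, hj2⟩ : ∃ j ≤ n, q * n₀ ≤ (x - (n₀ + j : ℕ)) * (1 - q) ∧
        (x - (n₀ + j : ℕ)) * (1 - q) ≤ q * (n₀ + n) := by
      have hu : 0 ≤ x - n₀ / (1 - q) := by
        rw [sub_nonneg, div_le_iff₀ h1q]; exact hx1
      have hcancel : (n₀ : ℝ) / (1 - q) * (1 - q) = n₀ := div_mul_cancel₀ _ h1q.ne'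
      rcases le_total ⌊x - n₀ / (1 - q)⌋₊ n with h | h
      · refine ⟨_, h, ?_, ?_⟩
        · have := Nat.floor_le hu
          push_cast
          nlinarith
        · have := Nat.lt_floor_add_one (x - n₀ / (1 - q))
          push_cast
          nlinarith
      · refine ⟨n, le_rfl, ?_, ?_⟩
        · have := (Nat.le_floor_iff hu).1 h
          push_cast
          nlinarith
        · push_cast
          nlinarith
    refine ⟨((n₀ + j : ℕ), ⟨(x - (n₀ + j : ℕ)) / q, ?_, ?_⟩), hsub j hj, ?_⟩
    · rw [div_le_div_iff₀ h1q hq0]; linarith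
    · rw [div_le_div_iff₀ hq0 h1q]; linarith
    · simp only
      field_simp
      ring
  choose f hfD hf using step
  intro x hx
  let u : ℕ → I := fun N => (fun y => (f y).2)^[N] ⟨x, hx⟩
  have hu : ∀ N, (u N : ℝ) = (f (u N)).1 + q * u (N + 1) := fun N => by
    rw [hf (u N)]
    simp only [u, Function.iterate_succ_apply']
  refine ⟨fun N => (f (u N)).1, fun N => hfD _, ?_⟩
  rw [(summable_digits hq0 hq1 hD fun N => hfD (u N)).hasSum_iff_tendsto_nat]
  have hpart : ∀ N, ∑ i ∈ Finset.range N, (f (u i)).1 * q ^ i = x - q ^ N * u N := by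
    intro N
    induction N with
    | zero => simp [u]
    | succ N ih => rw [Finset.sum_range_succ, ih, hu N]; ring
  simp only [hpart]
  suffices h : Tendsto (fun N => q ^ N * (u N : ℝ)) atTop (𝓝 0) by simpa using h.const_sub x
  refine (tendsto_pow_atTop_nhds_zero_of_lt_one hq0.le hq1).zero_mul_isBoundedUnder_le ?_
  refine isBoundedUnder_of ⟨(n₀ + n) / (1 - q), fun N => ?_⟩
  have h1 := (u N).2.1
  have h0 : 0 ≤ (n₀ : ℝ) / (1 - q) := by positivity
  simp only [Function.comp, Real.norm_eq_abs]
  rw [abs_of_nonneg (h0.trans h1)]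
  exact (u N).2.2

variable {κ : ℝ}

/-- If every nonzero digit is at least `κ`, then the gap of the digit set below `κ` is
repeated at every scale. -/
theorem pow_mul_notMem_digitSet (hq0 : 0 < q) (hq1 : q < 1) (hD : D ⊆ Icc 0 K)
    (hmin : ∀ d ∈ D, d = 0 ∨ κ ≤ d) {c : ℝ} (hc : q * (K / (1 - q)) < c) (hcκ : c < κ) (j : ℕ) :
    q ^ j * c ∉ digitSet D q := by
  -- Since q^i c ≤ c < κ, the leading digit vanishes, so the scale can be lowered by one until c
  -- itself is reached, beyond qE.
  have hdigit : ∀ i : ℕ, ∀ d ∈ D, ∀ y ∈ digitSet D q, q ^ i * c = d + q * y → d = 0 := by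
    intro i d hd y hy hdy
    have hyI := digitSet_subset_Icc hq0 hq1 hD hy
    have hc0 : 0 < c := lt_of_le_of_lt (mul_nonneg hq0.le (hyI.1.trans hyI.2)) hc
    have h1 : q ^ i * c ≤ c := mul_le_of_le_one_left hc0.le (pow_le_one₀ hq0.le hq1.le)
    have h2 := mul_nonneg hq0.le hyI.1
    exact (hmin d hd).resolve_right fun h => by linarith
  induction j with
  | zero =>
    intro h
    obtain ⟨d, hd, y, hy, hdy⟩ := (mem_digitSet_iff hq0).1 h
    have hd0 := hdigit 0 d hd y hy hdy
    have := mul_le_mul_of_nonneg_left (digitSet_subset_Icc hq0 hq1 hD hy).2 hq0.le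
    rw [pow_zero, hd0] at hdy
    linarith
  | succ j ih =>
    intro h
    obtain ⟨d, hd, y, hy, hdy⟩ := (mem_digitSet_iff hq0).1 h
    have hd0 := hdigit (j + 1) d hd y hy hdy
    have hy' : q ^ j * c = y := by
      apply mul_left_cancel₀ hq0.ne'
      rw [pow_succ, hd0] at hdy
      linarith
    exact ih (hy' ▸ hy)

theorem not_isFiniteUnionOfIntervals_digitSet (hq0 : 0 < q) (hq1 : q < 1) (hD : D ⊆ Icc 0 K)
    (h0 : (0 : ℝ) ∈ D) (hκD : κ ∈ D) (hmin : ∀ d ∈ D, d = 0 ∨ κ ≤ d)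
    (hgap : q * (K / (1 - q)) < κ) : ¬ IsFiniteUnionOfIntervals (digitSet D q) := by
  rintro ⟨I, hI, hconn, hE⟩
  have hκ : 0 ≤ κ := (hD hκD).1
  have hmem : ∀ j : ℕ, q ^ j * κ ∈ digitSet D q := by
    intro j
    induction j with
    | zero => exact (mem_digitSet_iff hq0).2 ⟨κ, hκD, 0, zero_mem_digitSet h0, by ring⟩
    | succ j ih => exact (mem_digitSet_iff hq0).2 ⟨0, h0, _, ih, by ring⟩
  have hJ : ∀ j : ℕ, ∃ J : I, q ^ j * κ ∈ (J : Set ℝ) := fun j => by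
    obtain ⟨J, hJ, hj⟩ := hE ▸ hmem j
    exact ⟨⟨J, hJ⟩, hj⟩
  choose f hf using hJ
  have : Finite I := hI
  -- Pigeonhole: one interval holds both q^j κ and q^i κ, hence also the gap point q^i c between
  -- them.
  obtain ⟨i, j, hne, hij⟩ := Finite.exists_ne_map_eq_of_infinite f
  wlog hlt : i < j generalizing i j
  · exact this j i hne.symm hij.symm (lt_of_le_of_ne (not_lt.1 hlt) hne.symm)
  obtain ⟨c, hc, hcκ⟩ := exists_between hgap
  refine pow_mul_notMem_digitSet hq0 hq1 hD hmin hc hcκ i ?_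
  rw [hE]
  refine ⟨f i, (f i).2, (hconn _ (f i).2).out (hij ▸ hf j) (hf i) ⟨?_, ?_⟩⟩
  · have h1 : q ^ j ≤ q ^ (i + 1) := pow_le_pow_of_le_one hq0.le hq1.le hlt
    have h2 : κ ≤ K / (1 - q) := by
      rw [le_div_iff₀ (by linarith)]
      nlinarith [(hD hκD).2]
    calc q ^ j * κ ≤ q ^ (i + 1) * κ := mul_le_mul_of_nonneg_right h1 hκ
      _ = q ^ i * (q * κ) := by ring
      _ ≤ q ^ i * c :=
        mul_le_mul_of_nonneg_left ((mul_le_mul_of_nonneg_left h2 hq0.le).trans hc.le)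
          (by positivity)
  · exact mul_le_mul_of_nonneg_left hcκ.le (by positivity)

/-- Gaps accumulate from the right at the right endpoint of every gap. -/
theorem exists_notMem_digitSet_right (hq0 : 0 < q) (hq1 : q < 1) (hfin : D.Finite)
    (hD : D ⊆ Icc 0 K) (h0 : (0 : ℝ) ∈ D) (hmin : ∀ d ∈ D, d = 0 ∨ κ ≤ d)
    (hgap : q * (K / (1 - q)) < κ) {g h : ℝ} (hgh : g < h) (hh : h ∈ digitSet D q)
    (hempty : ∀ x ∈ Ioo g h, x ∉ digitSet D q) {y : ℝ} (hy : h < y) :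
    ∃ z ∈ Ioo h y, z ∉ digitSet D q := by
  have hlim (C : ℝ) : Tendsto (fun N : ℕ => q ^ N * C) atTop (𝓝 0) := by
    simpa using (tendsto_pow_atTop_nhds_zero_of_lt_one hq0.le hq1).mul_const C
  -- Tails of order N are shorter than the gap, so no partial sum at or below g can reach h.
  obtain ⟨N, hN⟩ := ((hlim (K / (1 - q))).eventually_lt_const (sub_pos.2 hgh)).exists
  have hqN : 0 < q ^ N := pow_pos hq0 N
  have hbd : ∀ t ∈ digitSet D q, 0 ≤ q ^ N * t ∧ q ^ N * t < h - g := fun t ht =>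
    have ht := digitSet_subset_Icc hq0 hq1 hD ht
    ⟨mul_nonneg hqN.le ht.1, (mul_le_mul_of_nonneg_left ht.2 hqN.le).trans_lt hN⟩
  have hleft : ∀ s ∈ digitPartialSums D q N, s < h → s ≤ g := fun s hs hsh => by
    by_contra! hgs
    exact hempty s ⟨hgs, hsh⟩ (digitPartialSums_subset hq0 h0 N hs)
  -- Only finitely many partial sums exist, so those beyond h keep a distance from it.
  have hsep : ∀ᶠ x in 𝓝[>] h, ∀ s ∈ digitPartialSums D q N, h < s → x < s := by
    rw [(digitPartialSums_finite hfin N).eventually_all]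
    intro s _
    by_cases hs : h < s
    · filter_upwards [nhdsWithin_le_nhds (eventually_lt_nhds hs)] with x hx _ using hx
    · exact Eventually.of_forall fun x hx => absurd hx hs
  obtain ⟨c, hc, hcκ⟩ := exists_between hgap
  have hc0 : 0 < c := by
    have := digitSet_subset_Icc hq0 hq1 hD hh
    exact lt_of_le_of_lt (mul_nonneg hq0.le (this.1.trans this.2)) hc
  have hconv : Tendsto (fun j : ℕ => h + q ^ N * (q ^ j * c)) atTop (𝓝[>] h) := by
    refine tendsto_nhdsWithin_iff.2 ⟨?_, Eventually.of_forall fun j => ?_⟩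
    · simpa using ((hlim c).const_mul (q ^ N)).const_add h
    · simp only [mem_Ioi, lt_add_iff_pos_right]
      positivity
  obtain ⟨j, hj, hjy⟩ := (hconv.eventually (hsep.and (Ioo_mem_nhdsGT hy))).exists
  refine ⟨_, hjy, fun hmem => ?_⟩
  obtain ⟨s, hs, t, ht, hst⟩ := (mem_digitSet_iff_partialSums hq0 N).1 hmem
  have htb := hbd t ht
  rcases lt_trichotomy s h with hsh | rfl | hsh
  · linarith [hleft s hs hsh, hjy.1]
  · rw [add_right_inj, mul_right_inj' hqN.ne'] at hst
    exact pow_mul_notMem_digitSet hq0 hq1 hD hmin hc hcκ j (hst ▸ ht)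
  · linarith [hj s hs hsh]

end DigitSet

/-! ### One-point components and the Cantorval property -/

section Components

theorem mem_onePointComponents_of_gaps {S : Set ℝ} {g h : ℝ} (hgh : g < h) (hh : h ∈ S)
    (hleft : ∀ x ∈ Ioo g h, x ∉ S) (hright : ∀ y > h, ∃ z ∈ Ioo h y, z ∉ S) :
    h ∈ onePointComponents S := by
  refine ⟨hh, Subset.antisymm (fun y hy => ?_)
    (singleton_subset_iff.2 (mem_connectedComponentIn hh))⟩
  have hord : (connectedComponentIn S h).OrdConnected :=
    isPreconnected_connectedComponentIn.ordConnected
  have hmem := mem_connectedComponentIn hh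
  rcases lt_trichotomy y h with hlt | rfl | hlt
  · obtain ⟨z, hz1, hz2⟩ := exists_between (max_lt hgh hlt)
    exact absurd (connectedComponentIn_subset S h
      (hord.out hy hmem ⟨((le_max_right _ _).trans_lt hz1).le, hz2.le⟩))
      (hleft z ⟨(le_max_left _ _).trans_lt hz1, hz2⟩)
  · rfl
  · obtain ⟨z, hz, hzS⟩ := hright y hlt
    exact absurd (connectedComponentIn_subset S h (hord.out hmem hy ⟨hz.1.le, hz.2.le⟩)) hzS

/-- If the right endpoint of every gap of a closed set is a one-point component, then the left
endpoint of every nondegenerate component is a limit of one-point components. -/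
theorem accPt_onePointComponents_of_isLeast {S : Set ℝ} (hS : IsClosed S)
    (hgaps : ∀ g h, g < h → h ∈ S → (∀ x ∈ Ioo g h, x ∉ S) → h ∈ onePointComponents S)
    {x a : ℝ} (hint : (interior (connectedComponentIn S x)).Nonempty)
    (ha : IsLeast (connectedComponentIn S x) a) : AccPt a (𝓟 (onePointComponents S)) := by
  have haS : a ∈ S := connectedComponentIn_subset S x ha.1
  have hcomp : connectedComponentIn S x = connectedComponentIn S a := connectedComponentIn_eq ha.1
  have hnot : a ∉ onePointComponents S := fun h => by
    rw [hcomp, h.2, interior_singleton] at hint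
    exact not_nonempty_empty hint
  rw [accPt_iff_nhds]
  intro U hU
  obtain ⟨l, hl, hlU⟩ := exists_Ioc_subset_of_mem_nhds hU ⟨a - 1, by linarith⟩
  obtain ⟨y, hy, hyS⟩ : ∃ y ∈ Ioo l a, y ∈ S := by
    by_contra! h
    exact hnot (hgaps l a hl haS h)
  obtain ⟨z, hz, hzS⟩ : ∃ z ∈ Icc y a, z ∉ S := by
    by_contra! h
    have : Icc y a ⊆ connectedComponentIn S a :=
      isPreconnected_Icc.subset_connectedComponentIn (right_mem_Icc.2 hy.2.le) h
    have hle := ha.2 (hcomp ▸ this (left_mem_Icc.2 hy.2.le))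
    exact hle.not_gt hy.2
  -- The first point of S after z ∉ S is the right end of a gap.
  obtain ⟨h, hleast⟩ := (isCompact_Icc.inter_right hS : IsCompact (Icc z a ∩ S)).exists_isLeast
    ⟨a, right_mem_Icc.2 hz.2, haS⟩
  have hzh : z < h := lt_of_le_of_ne hleast.1.1.1 fun e => hzS (e ▸ hleast.1.2)
  have hone : h ∈ onePointComponents S := hgaps z h hzh hleast.1.2 fun t ht htS =>
    (hleast.2 ⟨⟨ht.1.le, ht.2.le.trans hleast.1.1.2⟩, htS⟩).not_gt ht.2
  exact ⟨h, ⟨hlU ⟨hy.1.trans (hz.1.trans_lt hzh), hleast.1.1.2⟩, hone⟩, fun e => hnot (e ▸ hone)⟩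

theorem image_connectedComponentIn_of_image_eq {X : Type*} [TopologicalSpace X] (e : X ≃ₜ X)
    {S : Set X} (hS : e '' S = S) {x : X} (hx : x ∈ S) :
    e '' connectedComponentIn S x = connectedComponentIn S (e x) := by
  rw [e.image_connectedComponentIn hx, hS]

theorem image_onePointComponents_of_image_eq (e : ℝ ≃ₜ ℝ) {S : Set ℝ} (hS : e '' S = S) :
    e '' onePointComponents S ⊆ onePointComponents S := by
  rintro _ ⟨z, ⟨hz, hcomp⟩, rfl⟩
  refine ⟨hS ▸ mem_image_of_mem e hz, ?_⟩
  rw [← image_connectedComponentIn_of_image_eq e hS hz, hcomp, image_singleton]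

theorem isCantorval_digitSet {D : Set ℝ} {q K κ : ℝ} (hq0 : 0 < q) (hq1 : q < 1)
    (hfin : D.Finite) (hD : D ⊆ Icc 0 K) (hsymm : ∀ d ∈ D, K - d ∈ D) (h0 : (0 : ℝ) ∈ D)
    (hmin : ∀ d ∈ D, d = 0 ∨ κ ≤ d) (hgap : q * (K / (1 - q)) < κ)
    (hint : (interior (digitSet D q)).Nonempty) : IsCantorval (digitSet D q) := by
  have hcpt := isCompact_digitSet hq0 hq1 hfin hD
  have hgaps : ∀ g h, g < h → h ∈ digitSet D q → (∀ x ∈ Ioo g h, x ∉ digitSet D q) →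
      h ∈ onePointComponents (digitSet D q) := fun g h hgh hh hempty =>
    mem_onePointComponents_of_gaps hgh hh hempty fun y hy =>
      exists_notMem_digitSet_right hq0 hq1 hfin hD h0 hmin hgap hgh hh hempty hy
  have haccl := fun x a => accPt_onePointComponents_of_isLeast hcpt.isClosed hgaps (x := x) (a := a)
  refine ⟨⟨0, zero_mem_digitSet h0⟩, hcpt, closure_interior_digitSet hq0 hq1 hfin hD hint,
    fun x _ hx a ha => haccl x a hx ha, fun x hxE hx b hb => ?_⟩
  -- The reflection of E exchanges left and right endpoints of components.
  let e : ℝ ≃ₜ ℝ := Homeomorph.subLeft (K / (1 - q))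
  have he : ∀ t, e t = K / (1 - q) - t := fun t => rfl
  have hee : ∀ t, e (e t) = t := fun t => sub_sub_cancel _ _
  have hE : e '' digitSet D q = digitSet D q := by
    have hsub : e '' digitSet D q ⊆ digitSet D q :=
      image_subset_iff.2 fun t ht => sub_mem_digitSet hq0 hq1 hsymm ht
    exact hsub.antisymm fun t ht => ⟨e t, hsub (mem_image_of_mem e ht), hee t⟩
  have hC := image_connectedComponentIn_of_image_eq e hE hxE
  have hacc := haccl (e x) (e b) (by rw [← hC, ← e.image_interior]; exact hx.image e) (by
    rw [← hC]
    refine ⟨mem_image_of_mem e hb.1, ?_⟩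
    rintro _ ⟨t, ht, rfl⟩
    exact sub_le_sub_left (hb.2 ht) _)
  rw [accPt_iff_nhds] at hacc ⊢
  intro U hU
  obtain ⟨t, ⟨htU, ht⟩, hne⟩ := hacc (e ⁻¹' U)
    (e.continuous.continuousAt.preimage_mem_nhds (by rwa [hee]))
  exact ⟨e t, ⟨htU, image_onePointComponents_of_image_eq e hE (mem_image_of_mem e ht)⟩,
    fun h => hne (by rw [← h, hee])⟩

end Components

/-! ### From multigeometric sequences to digit sets -/

section Multigeometric

variable {m : ℕ} {k : Fin m → ℕ}

/-- The set of subsums of the finite family `k`, as real numbers. -/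
def subsums (k : Fin m → ℕ) : Set ℝ :=
  (fun s : ℕ => (s : ℝ)) '' {s | IsSubsum k s}

theorem IsSubsum.le_sum {s : ℕ} (h : IsSubsum k s) : s ≤ ∑ i, k i := by
  obtain ⟨ε, hε, rfl⟩ := h
  exact Finset.sum_le_sum fun i _ => by rcases hε i with h | h <;> simp [h]

theorem isSubsum_zero : IsSubsum k 0 :=
  ⟨fun _ => 0, fun _ => Or.inl rfl, by simp⟩

theorem isSubsum_apply (i : Fin m) : IsSubsum k (k i) :=
  ⟨Pi.single i 1, fun j => by by_cases h : j = i <;> simp [h],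
    by simp [Pi.single_apply]⟩

/-- Complementing the selection gives the symmetry of the digits. -/
theorem IsSubsum.sum_sub {s : ℕ} (h : IsSubsum k s) : IsSubsum k (∑ i, k i - s) := by
  have hle := h.le_sum
  obtain ⟨ε, hε, rfl⟩ := h
  refine ⟨fun i => 1 - ε i, fun i => by rcases hε i with h | h <;> simp [h], ?_⟩
  rw [Nat.sub_eq_iff_eq_add hle, ← Finset.sum_add_distrib]
  exact Finset.sum_congr rfl fun i _ => by rcases hε i with h | h <;> simp [h]

theorem IsSubsum.eq_zero_or_le {s c : ℕ} (h : IsSubsum k s) (hc : ∀ i, c ≤ k i) :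
    s = 0 ∨ c ≤ s := by
  obtain ⟨ε, hε, rfl⟩ := h
  by_cases hall : ∀ i, ε i = 0
  · simp [hall]
  · push Not at hall
    obtain ⟨i, hi⟩ := hall
    have h1 : ε i = 1 := (hε i).resolve_left hi
    refine Or.inr ((hc i).trans ?_)
    have := Finset.single_le_sum (f := fun i => ε i * k i) (fun _ _ => Nat.zero_le _)
      (Finset.mem_univ i)
    simpa [h1] using this

theorem finite_subsums : (subsums k).Finite :=
  ((finite_Iic (∑ i, k i)).subset fun _ h => IsSubsum.le_sum h).image _

theorem subsums_subset_Icc : subsums k ⊆ Icc 0 (∑ i, (k i : ℝ)) := by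
  rintro _ ⟨s, hs, rfl⟩
  exact ⟨Nat.cast_nonneg s, by simpa using (Nat.cast_le (α := ℝ)).2 (IsSubsum.le_sum hs)⟩

theorem sum_sub_mem_subsums {d : ℝ} (hd : d ∈ subsums k) : ∑ i, (k i : ℝ) - d ∈ subsums k := by
  obtain ⟨s, hs, rfl⟩ := hd
  exact ⟨_, hs.sum_sub, by simp [Nat.cast_sub hs.le_sum]⟩

theorem summable_subfamily {q : ℝ} (hq0 : 0 < q) (hq1 : q < 1) {ε : ℕ × Fin m → ℝ}
    (hε : ∀ p, ε p = 0 ∨ ε p = 1) : Summable fun p : ℕ × Fin m => ε p * (k p.2 * q ^ p.1) := by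
  have hs : Summable fun p : ℕ × Fin m => q ^ p.1 * (k p.2 : ℝ) :=
    (summable_geometric_of_lt_one hq0.le hq1).mul_of_nonneg
      (Summable.of_finite (f := fun i : Fin m => (k i : ℝ)))
      (fun _ => by positivity) fun _ => by positivity
  refine Summable.of_nonneg_of_le (fun p => ?_) (fun p => ?_) hs
  · rcases hε p with h | h <;> rw [h] <;> positivity
  · have : 0 ≤ q ^ p.1 * (k p.2 : ℝ) := by positivity
    rcases hε p with h | h <;> rw [h] <;> linarith

/-- Grouping the terms of a multigeometric sequence into blocks of length `m`. -/
theorem achievementSet_multigeometric (hm : 0 < m) {q : ℝ} (hq0 : 0 < q) (hq1 : q < 1) :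
    achievementSet (multigeometric hm k q) = digitSet (subsums k) q := by
  have : NeZero m := ⟨hm.ne'⟩
  have hreindex : ∀ (ε : ℕ → ℝ) (t : ℝ), HasSum (fun i => ε i * multigeometric hm k q i) t ↔
      HasSum (fun p : ℕ × Fin m =>
        ε ((Nat.divModEquiv m).symm p) * ((k p.2 : ℝ) * q ^ p.1)) t := by
    intro ε t
    rw [← (Nat.divModEquiv m).hasSum_iff]
    refine iff_of_eq (congrArg (HasSum · t) (funext fun i => ?_))
    simp only [Function.comp, Equiv.symm_apply_apply, multigeometric]
    congr
  have hblock : ∀ (ε : ℕ × Fin m → ℝ), (∀ p, ε p = 0 ∨ ε p = 1) →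
      HasSum (fun n => (∑ i, ε (n, i) * k i) * q ^ n)
        (∑' p : ℕ × Fin m, ε p * ((k p.2 : ℝ) * q ^ p.1)) := by
    intro ε hε
    have := (summable_subfamily (k := k) hq0 hq1 hε).hasSum.prod_fiberwise fun n => hasSum_fintype _
    simpa only [Finset.sum_mul, mul_assoc] using this
  ext t
  constructor
  · rintro ⟨ε, hε, ht⟩
    rw [hreindex] at ht
    have h := hblock (fun p => ε ((Nat.divModEquiv m).symm p)) fun p => hε _
    rw [ht.tsum_eq] at h
    refine ⟨_, fun n => ?_, h⟩
    choose δ hδ hεδ using fun i => show ∃ δ : ℕ, (δ = 0 ∨ δ = 1) ∧ ε i = δ by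
      rcases hε i with h | h
      exacts [⟨0, by simp [h]⟩, ⟨1, by simp [h]⟩]
    exact ⟨_, ⟨fun i => δ ((Nat.divModEquiv m).symm (n, i)), fun i => hδ _, rfl⟩, by simp [hεδ]⟩
  · rintro ⟨a, ha, ht⟩
    choose s hs hsa using ha
    choose δ hδ hsδ using hs
    have hδ' : ∀ p : ℕ × Fin m, (δ p.1 p.2 : ℝ) = 0 ∨ (δ p.1 p.2 : ℝ) = 1 := fun p => by
      exact_mod_cast hδ p.1 p.2
    have hsum := summable_subfamily (k := k) hq0 hq1 hδ'
    have h := hblock _ hδ'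
    have ha : (fun n => (∑ i, (δ n i : ℝ) * k i) * q ^ n) = fun n => a n * q ^ n := by
      funext n
      rw [← hsa, hsδ]
      push_cast
      rfl
    simp only [ha] at h
    refine ⟨fun i => δ (Nat.divModEquiv m i).1 (Nat.divModEquiv m i).2, fun i => hδ' _, ?_⟩
    rw [hreindex, ht.unique h]
    simpa only [Equiv.apply_symm_apply] using hsum.hasSum

end Multigeometric

theorem theorem2 {m : ℕ} (hm : 0 < m) (k : Fin m → ℕ)
    (hkpos : ∀ i, 0 < k i) (hkanti : Antitone k)
    (n₀ n : ℕ) (hn₀ : 0 < n₀) (hn : 0 < n)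
    (hsub : ∀ j ≤ n, IsSubsum k (n₀ + j))
    (q : ℝ) (hq0 : 0 < q) (hq : q < 1 / 2) :
    (1 / ((n : ℝ) + 1) ≤ q →
      (interior (achievementSet (multigeometric hm k q))).Nonempty) ∧
    (q < (k ⟨m - 1, Nat.sub_one_lt_of_lt hm⟩ : ℝ) /
          ((∑ i, (k i : ℝ)) + (k ⟨m - 1, Nat.sub_one_lt_of_lt hm⟩ : ℝ)) →
      ¬ IsFiniteUnionOfIntervals (achievementSet (multigeometric hm k q))) ∧
    (1 / ((n : ℝ) + 1) ≤ q →
      q < (k ⟨m - 1, Nat.sub_one_lt_of_lt hm⟩ : ℝ) /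
          ((∑ i, (k i : ℝ)) + (k ⟨m - 1, Nat.sub_one_lt_of_lt hm⟩ : ℝ)) →
      IsCantorval (achievementSet (multigeometric hm k q))) := by
  have hq1 : q < 1 := by linarith
  have h1q : 0 < 1 - q := by linarith
  set κ : Fin m := ⟨m - 1, Nat.sub_one_lt_of_lt hm⟩
  have hκle : ∀ i, k κ ≤ k i := fun i => hkanti (Nat.le_sub_one_of_lt i.2)
  have h0 : (0 : ℝ) ∈ subsums k := ⟨0, isSubsum_zero, Nat.cast_zero⟩
  have hmin : ∀ d ∈ subsums k, d = 0 ∨ (k κ : ℝ) ≤ d := by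
    rintro _ ⟨s, hs, rfl⟩
    simpa using IsSubsum.eq_zero_or_le hs hκle
  have hgap : q < (k κ : ℝ) / ((∑ i, (k i : ℝ)) + (k κ : ℝ)) →
      q * ((∑ i, (k i : ℝ)) / (1 - q)) < k κ := fun h => by
    have hpos : 0 < (k κ : ℝ) := Nat.cast_pos.2 (hkpos κ)
    have hsum : 0 ≤ ∑ i, (k i : ℝ) := Finset.sum_nonneg fun _ _ => Nat.cast_nonneg _
    rw [lt_div_iff₀ (by linarith)] at h
    rw [← mul_div_assoc, div_lt_iff₀ h1q]
    linarith
  rw [achievementSet_multigeometric hm hq0 hq1]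
  have hint : 1 / ((n : ℝ) + 1) ≤ q → (interior (digitSet (subsums k) q)).Nonempty := fun h => by
    have hsubset := Icc_subset_digitSet hq0 hq1 subsums_subset_Icc
      (fun j hj => ⟨n₀ + j, hsub j hj, rfl⟩) h
    refine Nonempty.mono (interior_mono hsubset) ?_
    rw [interior_Icc, nonempty_Ioo]
    refine div_lt_div_of_pos_right ?_ h1q
    simpa using hn
  exact ⟨hint,
    fun h => not_isFiniteUnionOfIntervals_digitSet hq0 hq1 subsums_subset_Icc h0
      ⟨_, isSubsum_apply κ, rfl⟩ hmin (hgap h),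
    fun h1 h2 => isCantorval_digitSet hq0 hq1 finite_subsums subsums_subset_Icc
      (fun _ => sum_sub_mem_subsums) h0 hmin (hgap h2) (hint h1)⟩
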